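/- A weight on $[0,1)$ is a function $w:[0,1)\to(0,+\infty)$ that is non-decreasing, continuous and unbounded. It is log-convex if $x\mapsto\log w(e^x)$ is convex on $(-\infty,0)$, and doubling if there is a constant $d>0$ such that \[ \frac{w(1-2^{-n-1})}{w(1-2^{-n})}\le d\qquad\text{for all } n=0,1,2,\dots. \] For $0<p<\infty$ and a weight $w$ on $[0,1)$, the Hardy growth space $H_w^p(\mathbb D)$ consists of the holomorphic functions $f$ on the open unit disk $\mathbb D$ such that \[ \|f\|_{H_w^p}=\sup_{0\le r<1}\frac{M_p(f,r)}{w(r)}<\infty,\qquad M_p(f,r)=\Big(\frac1{2\pi}\int_0^{2\pi}|f(re^{i\theta})|^p\,d\theta\Big)^{1/p}. \] Theorem. Let $1\le p<\infty$, let $w$ be a log-convex weight on $[0,1)$, and put $u(r)=w(r)/(1-r)$ for $0\le r<1$. Then the differentiation operator $D f=f'$ is bounded from $H_w^p(\mathbb D)$ to $H_u^p(\mathbb D)$ (that is, $f'\in H_u^p(\mathbb D)$ for every $f\in H_w^p(\mathbb D)$, and there is a constant $C<\infty$ with $\|f'\|_{H_u^p}\le C\|f\|_{H_w^p}$ for all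 such $f$) if and only if $w$ is doubling. -/

import Mathlib

namespace HardyGrowth

/-- A weight on `[0, 1)`: positive, non-decreasing, continuous and unbounded. Only the values of `w`
on `[0, 1)` matter. -/
structure IsWeight (w : ℝ → ℝ) : Prop where
  pos : ∀ r ∈ Set.Ico (0 : ℝ) 1, 0 < w r
  monotoneOn : MonotoneOn w (Set.Ico 0 1)
  continuousOn : ContinuousOn w (Set.Ico 0 1)
  unbounded : ¬ BddAbove (w '' Set.Ico 0 1)

/-- `log (w r)` is a convex function of `log r`, `0 < r < 1`. -/
def LogConvex (w : ℝ → ℝ) : Prop :=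
  ConvexOn ℝ (Set.Iio 0) (fun x : ℝ => Real.log (w (Real.exp x)))

/-- There is `d > 0` with `w (1 - 2^{-n-1}) / w (1 - 2^{-n}) ≤ d` for all `n = 0, 1, 2, …`
(those `n` for which the points lie in `[0, 1)`). -/
def Doubling (w : ℝ → ℝ) : Prop :=
  ∃ d : ℝ, 0 < d ∧ ∀ n : ℕ, w (1 - (1 / 2 : ℝ) ^ (n + 1)) / w (1 - (1 / 2 : ℝ) ^ n) ≤ d

/-- The integral mean `M_p(f, r) = ((2π)⁻¹ ∫_0^{2π} |f (r e^{iθ})|^p dθ)^{1/p}`. -/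
noncomputable def mean (p : ℝ) (f : ℂ → ℂ) (r : ℝ) : ℝ :=
  ((2 * Real.pi)⁻¹ * ∫ θ in (0 : ℝ)..2 * Real.pi,
    ‖f ((r : ℂ) * Complex.exp ((θ : ℂ) * Complex.I))‖ ^ p) ^ (1 / p)

/-- `sup_{0 ≤ r < 1} M_p(f, r) / w r`, as an element of `[0, ∞]`. -/
noncomputable def growthNorm (p : ℝ) (w : ℝ → ℝ) (f : ℂ → ℂ) : ENNReal :=
  ⨆ r ∈ Set.Ico (0 : ℝ) 1, ENNReal.ofReal (mean p f r / w r)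

/-- The Hardy growth space on the unit disk: holomorphic functions with finite growth norm. Only the
values of `f` on the open unit disk matter. -/
def space (p : ℝ) (w : ℝ → ℝ) : Set (ℂ → ℂ) :=
  {f | DifferentiableOn ℂ f (Metric.ball 0 1) ∧ growthNorm p w f < ⊤}

/-- The differentiation operator is bounded from the space of `w` to the space of `u`: it maps the
former into the latter and `‖f'‖ ≤ C ‖f‖` for some finite constant `C`. -/
def DiffBounded (p : ℝ) (w u : ℝ → ℝ) : Prop :=
  Set.MapsTo deriv (space p w) (space p u) ∧
    ∃ C : NNReal, ∀ f ∈ space p w, growthNorm p u (deriv f) ≤ C * growthNorm p w f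

end HardyGrowth

/-! If `w` is doubling, Cauchy's formula on circles of radius `δ`, averaged by Jensen and Fubini,
bounds M_p(f', r) by `δ⁻¹` times the largest M_p(f, s) with s ≤ r + δ (`mean_deriv_le`). For δ = (1
- r)/2, doubling replaces w((1 + r)/2) by a multiple of w(r).

Conversely, test on z^n, whose means are r^n. At a maximum `s` of r^n / w(r) the weight cancels,
leaving n(1 - s) ≤ C (`mul_one_sub_le_of_isMaxOn`). By log-convexity, a secant of log w(e^x) over
[x, y] of slope at least n forces such a maximum to occur at some s ≤ e^y
(`exists_isMaxOn_pow_div`). So secant slopes are at most (C + 1)/(1 - e^y), which bounds the growth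
of log w between consecutive dyadic points. -/

namespace HardyGrowth

open MeasureTheory Set

/-! ### Integral means of the derivative -/

/-- The rotation invariance of the integral over a circle centred at the origin. -/
lemma integral_exp_mul_eq (g : ℂ → ℝ) (a : ℂ) :
    ∫ θ in (0 : ℝ)..2 * Real.pi, g (Complex.exp (θ * Complex.I) * a) =
      ∫ θ in (0 : ℝ)..2 * Real.pi, g (‖a‖ * Complex.exp (θ * Complex.I)) := by
  set h : ℝ → ℝ := fun θ => g (‖a‖ * Complex.exp (θ * Complex.I)) with hh
  have hper : Function.Periodic h (2 * Real.pi) := by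
    intro θ
    simp only [hh]
    congr 2
    push_cast
    rw [add_mul, Complex.exp_add, Complex.exp_two_pi_mul_I, mul_one]
  have h1 : ∀ θ : ℝ, g (Complex.exp (θ * Complex.I) * a) = h (θ + a.arg) := by
    intro θ
    simp only [hh]
    congr 1
    conv_lhs => rw [← Complex.norm_mul_exp_arg_mul_I a]
    push_cast
    rw [add_mul, Complex.exp_add]
    ring
  simp_rw [h1]
  rw [intervalIntegral.integral_comp_add_right, zero_add, add_comm (2 * Real.pi)]
  simpa using hper.intervalIntegral_add_eq a.arg 0

lemma norm_deriv_le_circle_mean {f : ℂ → ℂ} {c : ℂ} {δ : ℝ} (hδ : 0 < δ)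
    (hf : DifferentiableOn ℂ f (Metric.closedBall c δ)) :
    ‖deriv f c‖ ≤ δ⁻¹ * ((2 * Real.pi)⁻¹ *
      ∫ t in (0 : ℝ)..2 * Real.pi, ‖f (c + δ * Complex.exp (t * Complex.I))‖) := by
  have h1 := hf.deriv_eq_smul_circleIntegral hδ
  have h2 : ‖∮ z in C(c, δ), (1 / (z - c) ^ 2) • f z‖ ≤
      δ⁻¹ * ∫ t in (0 : ℝ)..2 * Real.pi, ‖f (c + δ * Complex.exp (t * Complex.I))‖ := by
    rw [circleIntegral, ← intervalIntegral.integral_const_mul]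
    refine (intervalIntegral.norm_integral_le_integral_norm Real.two_pi_pos.le).trans_eq ?_
    congr 1
    ext t
    simp only [deriv_circleMap, norm_smul, norm_mul, norm_circleMap_zero, abs_of_pos hδ,
      Complex.norm_I, circleMap_sub_center, norm_div, norm_one, norm_pow]
    rw [circleMap]
    field_simp
  rw [h1, norm_smul] at h2
  have h3 : ‖(2 * Real.pi * Complex.I : ℂ)‖ = 2 * Real.pi := by
    simp [abs_of_pos Real.pi_pos]
  rw [h3] at h2
  have hpi := Real.two_pi_pos
  rw [← mul_le_mul_iff_right₀ hpi]
  refine h2.trans_eq ?_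
  rw [mul_left_comm, mul_inv_cancel_left₀ hpi.ne']

/-- Jensen's inequality for `x ^ p` and the normalized integral over `[0, 2π]`. -/
lemma rpow_mean_le {p : ℝ} (hp : 1 ≤ p) {g : ℝ → ℝ} (hg : Continuous g) (h0 : ∀ t, 0 ≤ g t) :
    ((2 * Real.pi)⁻¹ * ∫ t in (0 : ℝ)..2 * Real.pi, g t) ^ p ≤
      (2 * Real.pi)⁻¹ * ∫ t in (0 : ℝ)..2 * Real.pi, g t ^ p := by
  have hpi := Real.two_pi_pos
  have hgp : Continuous fun t => g t ^ p :=
    hg.rpow_const fun _ => Or.inr (zero_le_one.trans hp)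
  have key := (convexOn_rpow hp).map_set_average_le (μ := volume)
    (t := Ioc 0 (2 * Real.pi)) (f := g)
    (continuousOn_id.rpow_const fun _ _ => Or.inr (zero_le_one.trans hp)) isClosed_Ici
    (by simp [Real.pi_pos]) measure_Ioc_lt_top.ne (Filter.Eventually.of_forall h0)
    (hg.integrableOn_Ioc) (hgp.integrableOn_Ioc)
  rw [setAverage_eq, setAverage_eq] at key
  simpa [intervalIntegral.integral_of_le hpi.le, Measure.real, hpi.le, Real.pi_pos.le] using key

lemma mean_nonneg (p : ℝ) (f : ℂ → ℂ) (r : ℝ) : 0 ≤ mean p f r := by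
  unfold mean
  have : 0 ≤ ∫ θ in (0 : ℝ)..2 * Real.pi,
      ‖f ((r : ℂ) * Complex.exp ((θ : ℂ) * Complex.I))‖ ^ p :=
    intervalIntegral.integral_nonneg Real.two_pi_pos.le fun _ _ => by positivity
  have := Real.pi_pos
  positivity

lemma mean_rpow {p : ℝ} (hp : 0 < p) (f : ℂ → ℂ) (r : ℝ) :
    mean p f r ^ p = (2 * Real.pi)⁻¹ * ∫ θ in (0 : ℝ)..2 * Real.pi,
      ‖f ((r : ℂ) * Complex.exp ((θ : ℂ) * Complex.I))‖ ^ p := by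
  unfold mean
  have : 0 ≤ ∫ θ in (0 : ℝ)..2 * Real.pi,
      ‖f ((r : ℂ) * Complex.exp ((θ : ℂ) * Complex.I))‖ ^ p :=
    intervalIntegral.integral_nonneg Real.two_pi_pos.le fun _ _ => by positivity
  have := Real.pi_pos
  rw [← Real.rpow_mul (by positivity), one_div_mul_cancel hp.ne', Real.rpow_one]

lemma integral_swap_of_continuous {F : ℝ → ℝ → ℝ} (hF : Continuous (Function.uncurry F))
    (a b c d : ℝ) :
    ∫ x in a..b, ∫ y in c..d, F x y = ∫ y in c..d, ∫ x in a..b, F x y := by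
  have hK : IsCompact (uIcc a b ×ˢ uIcc c d) := isCompact_uIcc.prod isCompact_uIcc
  exact intervalIntegral_intervalIntegral_swap <|
    (hF.continuousOn.integrableOn_compact hK).mono_set
      (prod_mono uIoc_subset_uIcc uIoc_subset_uIcc)

set_option maxHeartbeats 1000000 in
/-- The derivative on a circle is controlled by the integral means of the function on the slightly
larger disk. -/
lemma mean_deriv_le {p : ℝ} (hp : 1 ≤ p) {f : ℂ → ℂ}
    (hf : DifferentiableOn ℂ f (Metric.ball 0 1)) {r δ A : ℝ} (hr : 0 ≤ r) (hδ : 0 < δ)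
    (hrδ : r + δ < 1) (hA : ∀ s, 0 ≤ s → s ≤ r + δ → mean p f s ≤ A) :
    mean p (deriv f) r ≤ δ⁻¹ * A := by
  have hp0 : 0 < p := zero_lt_one.trans_le hp
  have hpi := Real.two_pi_pos
  have hA0 : 0 ≤ A := (mean_nonneg p f 0).trans (hA 0 le_rfl (by linarith))
  -- Turning the Cauchy circle by `θ` writes its points as e^{iθ}(r + δe^{it}). For fixed `t`,
  -- integrating in `θ` then gives a mean of `f` over one circle centred at 0, of radius at most r +
  -- δ.
  let F : ℝ → ℝ → ℝ := fun θ t =>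
    ‖f (Complex.exp (θ * Complex.I) * (r + δ * Complex.exp (t * Complex.I)))‖
  have hball : ∀ t : ℝ, ‖(r + δ * Complex.exp (t * Complex.I) : ℂ)‖ ≤ r + δ := fun t =>
    (norm_add_le _ _).trans (by simp [Complex.norm_exp_ofReal_mul_I, abs_of_nonneg, hr, hδ.le])
  have hF : Continuous (Function.uncurry F) := by
    refine (hf.continuousOn.comp_continuous (by fun_prop) fun x => ?_).norm
    simpa [Complex.norm_exp_ofReal_mul_I] using (hball x.2).trans_lt hrδ
  have hFp : Continuous (Function.uncurry fun θ t => F θ t ^ p) :=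
    hF.rpow_const fun _ => Or.inr hp0.le
  have h1 : ∀ θ : ℝ, ‖deriv f (r * Complex.exp (θ * Complex.I))‖ ^ p ≤
      δ⁻¹ ^ p * ((2 * Real.pi)⁻¹ * ∫ t in (0 : ℝ)..2 * Real.pi, F θ t ^ p) := by
    intro θ
    have hsub : Metric.closedBall (r * Complex.exp (θ * Complex.I)) δ ⊆ Metric.ball (0 : ℂ) 1 := by
      refine Metric.closedBall_subset_ball' ?_
      simp only [dist_zero_right, norm_mul, Complex.norm_exp_ofReal_mul_I, Complex.norm_real,
        Real.norm_of_nonneg hr]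
      linarith
    have h2 := norm_deriv_le_circle_mean hδ (hf.mono hsub)
    have h3 := integral_exp_mul_eq (fun ζ => ‖f (r * Complex.exp (θ * Complex.I) + ζ)‖)
      (δ * Complex.exp (θ * Complex.I))
    simp only [norm_mul, Complex.norm_exp_ofReal_mul_I, Complex.norm_real,
        Real.norm_of_nonneg hδ.le, mul_one] at h3
    have h4 : ∀ t : ℝ, r * Complex.exp (θ * Complex.I) +
        Complex.exp (t * Complex.I) * (δ * Complex.exp (θ * Complex.I)) =
        Complex.exp (θ * Complex.I) * (r + δ * Complex.exp (t * Complex.I)) := fun t => by ring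
    simp only [h4] at h3
    rw [← h3] at h2
    have hFc : Continuous (F θ) := hF.comp (by fun_prop : Continuous fun t : ℝ => (θ, t))
    have hI : 0 ≤ ∫ t in (0 : ℝ)..2 * Real.pi, F θ t :=
      intervalIntegral.integral_nonneg hpi.le fun _ _ => norm_nonneg _
    refine (Real.rpow_le_rpow (norm_nonneg _) h2 hp0.le).trans ?_
    rw [Real.mul_rpow (by positivity) (by positivity)]
    gcongr
    exact rpow_mean_le hp hFc fun _ => norm_nonneg _
  have h5 : ∀ t : ℝ, ∫ θ in (0 : ℝ)..2 * Real.pi, F θ t ^ p ≤ 2 * Real.pi * A ^ p := by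
    intro t
    have h6 := integral_exp_mul_eq (fun ζ => ‖f ζ‖ ^ p) (r + δ * Complex.exp (t * Complex.I))
    have h7 := mean_rpow hp0 f ‖(r + δ * Complex.exp (t * Complex.I) : ℂ)‖
    rw [← h6] at h7
    have h8 := Real.rpow_le_rpow (mean_nonneg _ _ _) (hA _ (norm_nonneg _) (hball t)) hp0.le
    rw [h7, inv_mul_le_iff₀ hpi] at h8
    exact h8
  have hder : Continuous fun θ : ℝ => ‖deriv f (r * Complex.exp (θ * Complex.I))‖ ^ p := by
    refine Continuous.rpow_const (Continuous.norm ?_) fun _ => Or.inr hp0.le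
    refine (hf.deriv Metric.isOpen_ball).continuousOn.comp_continuous (by fun_prop) fun θ => ?_
    simp only [Metric.mem_ball, dist_zero_right, norm_mul, Complex.norm_exp_ofReal_mul_I,
      Complex.norm_real, Real.norm_of_nonneg hr]
    linarith
  have hin : Continuous fun θ => ∫ t in (0 : ℝ)..2 * Real.pi, F θ t ^ p :=
    intervalIntegral.continuous_parametric_intervalIntegral_of_continuous' hFp _ _
  have hin' : Continuous fun t => ∫ θ in (0 : ℝ)..2 * Real.pi, F θ t ^ p :=
    intervalIntegral.continuous_parametric_intervalIntegral_of_continuous'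
      (f := fun t θ => F θ t ^ p) (hFp.comp continuous_swap) _ _
  have hswap : ∫ θ in (0 : ℝ)..2 * Real.pi, ∫ t in (0 : ℝ)..2 * Real.pi, F θ t ^ p =
      ∫ t in (0 : ℝ)..2 * Real.pi, ∫ θ in (0 : ℝ)..2 * Real.pi, F θ t ^ p :=
    integral_swap_of_continuous hFp _ _ _ _
  have hdouble : ∫ t in (0 : ℝ)..2 * Real.pi, ∫ θ in (0 : ℝ)..2 * Real.pi, F θ t ^ p ≤
      2 * Real.pi * (2 * Real.pi * A ^ p) := by
    refine (intervalIntegral.integral_mono_on hpi.le (hin'.intervalIntegrable _ _)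
      (intervalIntegrable_const) fun t _ => h5 t).trans_eq ?_
    simp
  have hmain : mean p (deriv f) r ^ p ≤ (δ⁻¹ * A) ^ p := by
    rw [mean_rpow hp0, inv_mul_le_iff₀ hpi, Real.mul_rpow (by positivity) hA0]
    refine (intervalIntegral.integral_mono_on hpi.le (hder.intervalIntegrable _ _)
      ((hin.const_mul _).const_mul _ |>.intervalIntegrable _ _) fun θ _ => h1 θ).trans ?_
    rw [intervalIntegral.integral_const_mul, intervalIntegral.integral_const_mul, hswap]
    calc _ ≤ δ⁻¹ ^ p * ((2 * Real.pi)⁻¹ * (2 * Real.pi * (2 * Real.pi * A ^ p))) := by gcongr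
      _ = _ := by field_simp
  exact (Real.rpow_le_rpow_iff (mean_nonneg _ _ _) (by positivity) hp0).1 hmain

/-! ### Doubling implies boundedness -/

lemma growthNorm_le_ofReal_iff {p : ℝ} {w : ℝ → ℝ} (hw : ∀ r ∈ Ico (0 : ℝ) 1, 0 < w r)
    {f : ℂ → ℂ} {K : ℝ} (hK : 0 ≤ K) :
    growthNorm p w f ≤ ENNReal.ofReal K ↔ ∀ r ∈ Ico (0 : ℝ) 1, mean p f r ≤ K * w r := by
  simp only [growthNorm, iSup_le_iff]
  refine forall₂_congr fun r hr => ?_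
  rw [ENNReal.ofReal_le_ofReal_iff hK, div_le_iff₀ (hw r hr)]

lemma Doubling.le_midpoint {w : ℝ → ℝ} (hw : IsWeight w) (hd : Doubling w) :
    ∃ D : ℝ, 0 ≤ D ∧ ∀ r ∈ Ico (0 : ℝ) 1, w ((1 + r) / 2) ≤ D * w r := by
  obtain ⟨d, hd0, hd⟩ := hd
  -- With 2^{-n-1} < 1 - r ≤ 2^{-n}, both `r` and its midpoint with 1 lie between 1 - 2^{-n} and 1 -
  -- 2^{-n-2}: two doubling steps.
  refine ⟨d * d, by positivity, fun r hr => ?_⟩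
  have h0 : 0 < 1 - r := sub_pos.2 hr.2
  obtain ⟨n, hn1, hn2⟩ := exists_nat_pow_near_of_lt_one h0 (by linarith [hr.1] : 1 - r ≤ 1)
    (by norm_num : (0 : ℝ) < 1 / 2) (by norm_num)
  have hmem : ∀ m : ℕ, (1 - (1 / 2 : ℝ) ^ m) ∈ Ico (0 : ℝ) 1 := fun m =>
    ⟨sub_nonneg.2 (pow_le_one₀ (by norm_num) (by norm_num)), by simp⟩
  have hstep : ∀ m : ℕ, w (1 - (1 / 2 : ℝ) ^ (m + 1)) ≤ d * w (1 - (1 / 2 : ℝ) ^ m) := fun m =>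
    (div_le_iff₀ (hw.pos _ (hmem m))).1 (hd m)
  have hp2 : (1 / 2 : ℝ) ^ (n + 2) = (1 / 2) ^ (n + 1) / 2 := by ring
  calc w ((1 + r) / 2) ≤ w (1 - (1 / 2 : ℝ) ^ (n + 2)) :=
        hw.monotoneOn ⟨by linarith [hr.1], by linarith⟩ (hmem _) (by linarith)
    _ ≤ d * w (1 - (1 / 2 : ℝ) ^ (n + 1)) := hstep _
    _ ≤ d * (d * w (1 - (1 / 2 : ℝ) ^ n)) := by gcongr; exact hstep _
    _ ≤ d * (d * w r) := by
        gcongr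
        exact hw.monotoneOn (hmem _) hr (by linarith)
    _ = d * d * w r := by ring

theorem Doubling.diffBounded {p : ℝ} (hp : 1 ≤ p) {w : ℝ → ℝ} (hw : IsWeight w)
    (hd : Doubling w) : DiffBounded p w (fun r => w r / (1 - r)) := by
  obtain ⟨D, hD0, hD⟩ := hd.le_midpoint hw
  have hu : ∀ r ∈ Ico (0 : ℝ) 1, 0 < w r / (1 - r) := fun r hr =>
    div_pos (hw.pos r hr) (sub_pos.2 hr.2)
  have key : ∀ f ∈ space p w, growthNorm p (fun r => w r / (1 - r)) (deriv f) ≤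
      (2 * D).toNNReal * growthNorm p w f := by
    intro f hf
    set K := (growthNorm p w f).toReal with hKdef
    have hK0 : 0 ≤ K := ENNReal.toReal_nonneg
    have hK : growthNorm p w f = ENNReal.ofReal K := (ENNReal.ofReal_toReal hf.2.ne).symm
    have hfK := (growthNorm_le_ofReal_iff hw.pos hK0).1 hK.le
    rw [hK, show ((2 * D).toNNReal : ENNReal) = ENNReal.ofReal (2 * D) from rfl,
      ← ENNReal.ofReal_mul (by positivity), growthNorm_le_ofReal_iff hu (by positivity)]
    intro r hr
    have h0 : 0 < 1 - r := sub_pos.2 hr.2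
    have hmid : r + (1 - r) / 2 = (1 + r) / 2 := by ring
    have h1 := mean_deriv_le hp hf.1 (r := r) (δ := (1 - r) / 2) (A := K * w ((1 + r) / 2)) hr.1
      (by linarith) (by linarith) fun s hs hs' => by
        rw [hmid] at hs'
        refine (hfK s ⟨hs, by linarith⟩).trans ?_
        gcongr
        exact hw.monotoneOn ⟨hs, by linarith⟩ ⟨by linarith, by linarith⟩ hs'
    refine h1.trans ?_
    calc ((1 - r) / 2)⁻¹ * (K * w ((1 + r) / 2)) ≤ ((1 - r) / 2)⁻¹ * (K * (D * w r)) := by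
          gcongr
          exact hD r hr
      _ = 2 * D * K * (w r / (1 - r)) := by field_simp
  refine ⟨fun f hf => ⟨hf.1.deriv Metric.isOpen_ball, ?_⟩, _, key⟩
  exact (key f hf).trans_lt (ENNReal.mul_lt_top ENNReal.coe_lt_top hf.2)

/-! ### Boundedness implies doubling, by testing on monomials -/

lemma mean_const_mul_pow {p : ℝ} (hp : 0 < p) {c r : ℝ} (hc : 0 ≤ c) (hr : 0 ≤ r) (n : ℕ) :
    mean p (fun z => (c : ℂ) * z ^ n) r = c * r ^ n := by
  have hpi := Real.two_pi_pos
  have h : mean p (fun z => (c : ℂ) * z ^ n) r ^ p = (c * r ^ n) ^ p := by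
    rw [mean_rpow hp]
    simp only [norm_mul, norm_pow, Complex.norm_exp_ofReal_mul_I, Complex.norm_real,
      Real.norm_of_nonneg hc, Real.norm_of_nonneg hr, mul_one, intervalIntegral.integral_const,
      sub_zero, smul_eq_mul]
    field_simp
  exact (Real.rpow_left_inj (mean_nonneg _ _ _) (by positivity) hp.ne').1 h

/-- Testing the differentiation operator on `z ^ n`, whose growth norm is attained at `s`. -/
lemma mul_one_sub_le_of_isMaxOn {p : ℝ} (hp : 0 < p) {w : ℝ → ℝ} (hw : IsWeight w) {C : NNReal}
    (hC : ∀ f ∈ space p w, growthNorm p (fun r => w r / (1 - r)) (deriv f) ≤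
      C * growthNorm p w f) {n : ℕ} {s : ℝ} (hs : s ∈ Ioo (0 : ℝ) 1)
    (hmax : IsMaxOn (fun r => r ^ n / w r) (Ico 0 1) s) : n * (1 - s) ≤ C := by
  have hws := hw.pos s ⟨hs.1.le, hs.2⟩
  have hK0 : 0 ≤ s ^ n / w s := by have := hs.1; positivity
  have hnorm : growthNorm p w (fun z => z ^ n) ≤ ENNReal.ofReal (s ^ n / w s) := by
    rw [growthNorm_le_ofReal_iff hw.pos hK0]
    intro r hr
    have := mean_const_mul_pow hp zero_le_one hr.1 n
    simp only [Complex.ofReal_one, one_mul] at this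
    rw [this, ← div_le_iff₀ (hw.pos r hr)]
    exact hmax hr
  have h1 := hC (fun z => z ^ n) ⟨by fun_prop, hnorm.trans_lt ENNReal.ofReal_lt_top⟩
  have hu : ∀ r ∈ Ico (0 : ℝ) 1, 0 < w r / (1 - r) := fun r hr =>
    div_pos (hw.pos r hr) (sub_pos.2 hr.2)
  have h2 : growthNorm p (fun r => w r / (1 - r)) (deriv fun z => z ^ n) ≤
      ENNReal.ofReal (C * (s ^ n / w s)) := by
    rw [ENNReal.ofReal_mul C.coe_nonneg, ENNReal.ofReal_coe_nnreal]
    exact h1.trans (by gcongr)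
  rw [growthNorm_le_ofReal_iff hu (by positivity)] at h2
  have h3 := h2 s ⟨hs.1.le, hs.2⟩
  have hder : (deriv fun z : ℂ => z ^ n) = fun z => ((n : ℝ) : ℂ) * z ^ (n - 1) := by
    ext z
    simp
  rw [hder, mean_const_mul_pow hp n.cast_nonneg hs.1.le] at h3
  rcases Nat.eq_zero_or_pos n with rfl | hn
  · simp
  have hs1 : 0 < 1 - s := sub_pos.2 hs.2
  have hs0 := hs.1
  have hsn : s ^ n = s ^ (n - 1) * s := by rw [← pow_succ, Nat.sub_add_cancel hn]
  rw [hsn] at h3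
  have h4 : C * (s ^ (n - 1) * s / w s) * (w s / (1 - s)) = s ^ (n - 1) * (C * s / (1 - s)) := by
    field_simp
  rw [h4, mul_comm, mul_le_mul_iff_right₀ (by positivity), le_div_iff₀ hs1] at h3
  exact h3.trans (mul_le_of_le_one_right C.coe_nonneg hs.2.le)

/-- A secant of slope at least `n` bounds the location of the maximum of `r ^ n / w r`. -/
lemma exists_isMaxOn_pow_div {w : ℝ → ℝ} (hw : IsWeight w) (hlc : LogConvex w) {n : ℕ}
    (hn : 0 < n) {x y : ℝ} (hxy : x < y) (hy : y < 0)
    (hslope : n ≤ (Real.log (w (Real.exp y)) - Real.log (w (Real.exp x))) / (y - x)) :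
    ∃ s ∈ Ioc 0 (Real.exp y), IsMaxOn (fun r => r ^ n / w r) (Ico 0 1) s := by
  have hey : Real.exp y < 1 := by simpa using hy
  have hey0 := Real.exp_pos y
  have hsub : Icc 0 (Real.exp y) ⊆ Ico (0 : ℝ) 1 := fun r hr => ⟨hr.1, hr.2.trans_lt hey⟩
  have hcont : ContinuousOn (fun r => r ^ n / w r) (Icc 0 (Real.exp y)) :=
    (by fun_prop : ContinuousOn (fun r : ℝ => r ^ n) _).div (hw.continuousOn.mono hsub)
      fun r hr => (hw.pos r (hsub hr)).ne'
  obtain ⟨s, hs, hmax⟩ := isCompact_Icc.exists_isMaxOn (nonempty_Icc.2 hey0.le) hcont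
  have hwy := hw.pos _ (hsub ⟨hey0.le, le_rfl⟩)
  have hys : Real.exp y ^ n / w (Real.exp y) ≤ s ^ n / w s := hmax ⟨hey0.le, le_rfl⟩
  have hs0 : s ≠ 0 := by
    rintro rfl
    rw [zero_pow hn.ne', zero_div] at hys
    exact absurd hys (not_le.2 (by positivity))
  refine ⟨s, ⟨lt_of_le_of_ne hs.1 hs0.symm, hs.2⟩, fun r hr => ?_⟩
  -- Past e^y, convexity keeps the slopes of log w(e^x) at least `n`, so r^n / w(r) never exceeds
  -- its value at e^y.
  rcases le_or_gt r (Real.exp y) with hle | hgt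
  · exact hmax ⟨hr.1, hle⟩
  refine le_trans ?_ hys
  have hr0 : 0 < r := hey0.trans hgt
  have hwr := hw.pos r hr
  have hyr : y < Real.log r := (Real.lt_log_iff_exp_lt hr0).2 hgt
  have h1 := hslope.trans (ConvexOn.slope_mono_adjacent hlc (hxy.trans hy)
    (Real.log_neg hr0 hr.2) hxy hyr)
  rw [Real.exp_log hr0, le_div_iff₀ (sub_pos.2 hyr)] at h1
  rw [← Real.log_le_log_iff (by positivity) (by positivity),
    Real.log_div (by positivity) hwr.ne', Real.log_div (by positivity) hwy.ne',
    Real.log_pow, Real.log_pow, Real.log_exp]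
  linarith

theorem DiffBounded.doubling {p : ℝ} (hp : 0 < p) {w : ℝ → ℝ} (hw : IsWeight w)
    (hlc : LogConvex w) (h : DiffBounded p w (fun r => w r / (1 - r))) : Doubling w := by
  obtain ⟨-, C, hC⟩ := h
  have hslope : ∀ x y : ℝ, x < y → y < 0 →
      (Real.log (w (Real.exp y)) - Real.log (w (Real.exp x))) / (y - x) * (1 - Real.exp y) ≤
        C + 1 := by
    intro x y hxy hy
    set l := (Real.log (w (Real.exp y)) - Real.log (w (Real.exp x))) / (y - x)
    have hey : Real.exp y < 1 := by simpa using hy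
    have hey0 := Real.exp_pos y
    have hfl := Nat.lt_floor_add_one l
    -- The exponent must be an integer; rounding the slope down costs at most 1 - e^y < 1, hence the
    -- constant C + 1.
    have hn : (⌊l⌋₊ : ℝ) * (1 - Real.exp y) ≤ C := by
      rcases Nat.eq_zero_or_pos ⌊l⌋₊ with h0 | h0
      · simp [h0]
      have hl : (⌊l⌋₊ : ℝ) ≤ l := Nat.floor_le (zero_le_one.trans (Nat.floor_pos.1 h0))
      obtain ⟨s, hs, hmax⟩ := exists_isMaxOn_pow_div hw hlc h0 hxy hy hl
      refine le_trans ?_ (mul_one_sub_le_of_isMaxOn hp hw hC ⟨hs.1, hs.2.trans_lt hey⟩ hmax)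
      gcongr
      exact hs.2
    nlinarith
  have hw0 := hw.pos 0 ⟨le_rfl, one_pos⟩
  have hw2 := hw.pos (1 / 2) ⟨by norm_num, by norm_num⟩
  -- The step n = 0 starts at r = 0, which has no logarithmic coordinate, so its ratio enters the
  -- constant separately.
  refine ⟨max (w (1 / 2) / w 0) (Real.exp (2 * (C + 1))), lt_max_of_lt_right (Real.exp_pos _),
    fun n => ?_⟩
  rcases Nat.eq_zero_or_pos n with rfl | hn
  · refine le_max_of_le_left (le_of_eq ?_)
    norm_num
  refine le_max_of_le_right ?_
  have hq0 : (0 : ℝ) < (1 / 2) ^ n := by positivity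
  have hq1 : (1 / 2 : ℝ) ^ n ≤ 1 / 2 := pow_le_of_le_one (by norm_num) (by norm_num) hn.ne'
  set q := (1 / 2 : ℝ) ^ n with hq
  have hsucc : (1 / 2 : ℝ) ^ (n + 1) = q / 2 := by rw [pow_succ]; ring
  rw [hsucc]
  have ha : 0 < 1 - q := by linarith
  have hb : 0 < 1 - q / 2 := by linarith
  have hwa := hw.pos (1 - q) ⟨ha.le, by linarith⟩
  have hwb := hw.pos (1 - q / 2) ⟨hb.le, by linarith⟩
  have hlog : Real.log (1 - q) < Real.log (1 - q / 2) := Real.log_lt_log ha (by linarith)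
  have h1 := hslope _ _ hlog (Real.log_neg hb (by linarith))
  rw [Real.exp_log ha, Real.exp_log hb, div_mul_eq_mul_div, div_le_iff₀ (sub_pos.2 hlog)] at h1
  -- Since q ≤ 1/2, log t ≤ t - 1 gives at most (q/2)/(1 - q) ≤ q. The slope bound has 1 - e^y =
  -- q/2, so log w grows by at most 2(C + 1).
  have h2 : Real.log (1 - q / 2) - Real.log (1 - q) ≤ q := by
    rw [← Real.log_div hb.ne' ha.ne']
    refine (Real.log_le_sub_one_of_pos (by positivity)).trans ?_
    rw [sub_le_iff_le_add, div_le_iff₀ ha]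
    nlinarith
  have h3 : (C + 1) * (Real.log (1 - q / 2) - Real.log (1 - q)) ≤ ((C : ℝ) + 1) * q := by
    gcongr
  rw [← Real.log_le_iff_le_exp (by positivity), Real.log_div hwb.ne' hwa.ne']
  nlinarith

end HardyGrowth

theorem mainTheorem3 (p : ℝ) (hp : 1 ≤ p) (w : ℝ → ℝ) (hw : HardyGrowth.IsWeight w)
    (hlc : HardyGrowth.LogConvex w) :
    HardyGrowth.DiffBounded p w (fun r => w r / (1 - r)) ↔ HardyGrowth.Doubling w :=
  ⟨fun h => h.doubling (zero_lt_one.trans_le hp) hw hlc, fun h => h.diffBounded hp hw⟩
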